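/- Let $\mathfrak g$ be a compact simple real Lie algebra (a simple real Lie algebra with negative definite Killing form $\kappa$), $v^{\mathfrak g}$ its dual Coxeter number, and $\langle X,Y\rangle_{\mathfrak g}=-\kappa(X,Y)/(2v^{\mathfrak g})$ its invariant scalar product, normalised such that long roots have squared length $2$. Let $k\ge 1$ be an integer. The current algebra of $\mathfrak g$ at level $k$ is given, in its vacuum representation, by the modes $j_n(X)$ ($n\in\mathbb Z$, $X\in\mathfrak g$, real linear in $X$) of the currents, acting on the complex inner product space $V$ of finite energy vectors and satisfying $$[j_m(X),j_n(Y)]=i\,j_{m+n}([X,Y])+k\,m\,\delta_{m+n,0}\,\langle X,Y\rangle_{\mathfrak g}\,1,\qquad j_n(X)^\dagger=j_{-n}(X),$$ with a unit vector $\Omega\in V$ which is cyclic for the $j_n(X)$ and satisfies $j_n(X)\Omega=0$ for all $n\ge 0$. Here $j_n(X)$ is the light-ray current $j^X(x)$ smeared with $\left(\frac{1+ix}{1-ix}\right)^n$. Normal ordered products are ${:}j(X)j(Y){:}_n=\sum_{m<0}j_m(X)j_{n-m}(Y)+\sum_{m\ge0}j_{n-m}(Y)j_m(X)$. Let $\iota:\mathfrak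 h\hookrightarrow\mathfrak g$ be an injective homomorphism of finite-dimensional real Lie algebras; then $\mathfrak h$ is reductive, the direct sum of its simple ideals and its centre, and these summands are denoted by $\mathfrak h_\alpha$. For a simple ideal $\mathfrak h_\alpha$ let $\langle\cdot,\cdot\rangle_\alpha$ be its normalised scalar product, $v^\alpha$ its dual Coxeter number, and $I_\alpha$ its Dynkin index, given by $\langle\iota X,\iota Y\rangle_{\mathfrak g}=I_\alpha\langle X,Y\rangle_\alpha$; for the centre put $I_\alpha=1$, $v^\alpha=0$, $\langle X,Y\rangle_\alpha=\langle\iota X,\iota Y\rangle_{\mathfrak g}$. The Sugawara stress-energy tensors $\Theta^{\mathfrak g}$ and $\Theta^{\mathfrak h}$ are given by their modes $$L^{\mathfrak g}_n=\frac{1}{2(k+v^{\mathfrak g})}\sum_{a,b}g^{\mathfrak g}_{ab}\,{:}j(T^a)j(T^b){:}_n,\qquad L^{\mathfrak h}_n=\sum_\alpha\frac{1}{2(I_\alpha k+v^\alpha)}\sum_{a,b}g^{\alpha}_{ab}\,{:}j(\iota T^a)j(\iota T^b){:}_n ,$$ where $(T^a)$ is a basis of $\mathfrak g$, respectively of $\mathfrak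 h_\alpha$, and $(g_{ab})$ is the inverse of its Gram matrix for the scalar product $\langle\cdot,\cdot\rangle$ concerned. The embedding is said to yield a conformal inclusion of the associated current algebras if $\Theta^{\mathfrak h}=\Theta^{\mathfrak g}$, i.e. $L^{\mathfrak h}_n=L^{\mathfrak g}_n$ on $V$ for all $n\in\mathbb Z$. Statement: if $\iota(\mathfrak h)\ne\mathfrak g$ and the embedding $\iota$ yields a conformal inclusion of the associated current algebras, then $k=1$. -/

import Mathlib

open scoped TensorProduct

noncomputable section

namespace ConformalInclusion

/-! ## Compact Lie algebras and normalised invariant forms -/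

section LieAlgebras

/-- A real Lie algebra with negative definite Killing form (a compact semisimple Lie algebra). -/
def HasNegDefKillingForm (L : Type*) [LieRing L] [LieAlgebra ℝ L] : Prop :=
  ∀ x : L, x ≠ 0 → killingForm ℝ L x x < 0

/-- The dual Coxeter number `v` of a compact simple Lie algebra `L`.
It is the number `v` such that the Killing form is `2 v` times the invariant form for which the
long roots have squared length `2`. In terms of the coroots `αᵛ` of the complexification, with
respect to a Cartan subalgebra, a root `α` has squared length `4 / κ (αᵛ, αᵛ)` for the Killing
form `κ`; the long roots are those whose coroots are shortest, so `v` is the least value of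
`κ (αᵛ, αᵛ) / 4`. -/
def dualCoxeterNumber (L : Type*) [LieRing L] [LieAlgebra ℝ L] [FiniteDimensional ℝ L] : ℝ :=
  sInf {r : ℝ | ∃ (_ : LieAlgebra.IsKilling ℂ (ℂ ⊗[ℝ] L))
    (H : LieSubalgebra ℂ (ℂ ⊗[ℝ] L)) (_ : H.IsCartanSubalgebra)
    (α : LieModule.Weight ℂ H (ℂ ⊗[ℝ] L)), α.IsNonZero ∧
      r = (killingForm ℂ (ℂ ⊗[ℝ] L) (LieAlgebra.IsKilling.coroot α : H)
        (LieAlgebra.IsKilling.coroot α : H)).re / 4}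

/-- The positive definite invariant form on a compact simple Lie algebra, normalised such that the
long roots have squared length `2`. -/
def normalizedForm (L : Type*) [LieRing L] [LieAlgebra ℝ L] [FiniteDimensional ℝ L] :
    LinearMap.BilinForm ℝ L :=
  (-(2 * dualCoxeterNumber L)⁻¹) • killingForm ℝ L

/-- The Dynkin index of a homomorphism of compact simple Lie algebras: the factor between the
pulled back normalised form of the target and the normalised form of the source. -/
def dynkinIndex {S L : Type*} [LieRing S] [LieAlgebra ℝ S] [FiniteDimensional ℝ S]
    [LieRing L] [LieAlgebra ℝ L] [FiniteDimensional ℝ L] (φ : S →ₗ⁅ℝ⁆ L) : ℝ :=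
  Classical.epsilon fun I : ℝ =>
    ∀ x y : S, normalizedForm L (φ x) (φ y) = I * normalizedForm S x y

end LieAlgebras

/-! ## Current algebras -/

/-- The current algebra of level `k` associated with a compact simple Lie algebra `𝔤`, on the space
`V` of finite energy vectors of its vacuum representation, in terms of Fourier modes.

`J.mode n X` is the current of colour `X` smeared with the test function
`x ↦ ((1 + i x) / (1 - i x)) ^ n` on the light ray. With this convention, the commutation relation
`[j^a(x), j^b(y)] = i f^{ab}_c j^c(x) δ(x - y) + k g^{ab} (i / 2π) δ'(x - y)`
becomes `comm`. -/
structure CurrentAlgebra (𝔤 : Type*) [LieRing 𝔤] [LieAlgebra ℝ 𝔤] [FiniteDimensional ℝ 𝔤] (k : ℕ)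
    (V : Type*) [NormedAddCommGroup V] [InnerProductSpace ℂ V] where
  /-- The modes of the currents. -/
  mode : ℤ → 𝔤 →ₗ[ℝ] Module.End ℂ V
  /-- The vacuum vector. -/
  vacuum : V
  /-- The commutation relations of the currents. -/
  comm : ∀ (m n : ℤ) (X Y : 𝔤),
    mode m X * mode n Y - mode n Y * mode m X =
      Complex.I • mode (m + n) ⁅X, Y⁆ +
        (if m + n = 0 then (k : ℂ) * (m : ℂ) * (normalizedForm 𝔤 X Y : ℂ) else 0) •
          (1 : Module.End ℂ V)
  /-- The currents are symmetric fields. -/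
  symm : ∀ (n : ℤ) (X : 𝔤) (v w : V), inner ℂ (mode n X v) w = inner ℂ v (mode (-n) X w)
  /-- The vacuum is normalised. -/
  norm_vacuum : ‖vacuum‖ = 1
  /-- The vacuum is invariant, and has lowest energy. -/
  mode_vacuum : ∀ (n : ℤ), 0 ≤ n → ∀ X : 𝔤, mode n X vacuum = 0
  /-- The vacuum is cyclic for the currents. -/
  cyclic : ∀ W : Submodule ℂ V, vacuum ∈ W → (∀ (n : ℤ) (X : 𝔤), ∀ v ∈ W, mode n X v ∈ W) → W = ⊤

namespace CurrentAlgebra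

variable {𝔤 : Type*} [LieRing 𝔤] [LieAlgebra ℝ 𝔤] [FiniteDimensional ℝ 𝔤] {k : ℕ}
  {V : Type*} [NormedAddCommGroup V] [InnerProductSpace ℂ V] (J : CurrentAlgebra 𝔤 k V)

/-- The `m`-th summand of the `n`-th mode of the normal ordered product of two currents:
creation operators (modes of negative index) of the first field stand to the left of the second
field, annihilation operators of the first field to the right. -/
def normalOrderedTerm (X Y : 𝔤) (n m : ℤ) : Module.End ℂ V :=
  if m < 0 then J.mode m X * J.mode (n - m) Y else J.mode (n - m) Y * J.mode m X

/-- The `n`-th mode `∑ₘ :j_m(X) j_{n-m}(Y):` of the normal ordered product of two currents. On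
every vector only finitely many summands do not vanish. -/
def normalOrderedMode (X Y : 𝔤) (n : ℤ) (v : V) : V :=
  ∑ᶠ m : ℤ, J.normalOrderedTerm X Y n m v

/-- Every vector is annihilated by all modes of sufficiently high index. -/
theorem exists_mode_eq_zero (v : V) : ∃ N : ℤ, ∀ n : ℤ, N ≤ n → ∀ X : 𝔤, J.mode n X v = 0 := by
  let W : Submodule ℂ V :=
    { carrier := {v | ∃ N : ℤ, ∀ n : ℤ, N ≤ n → ∀ X : 𝔤, J.mode n X v = 0}
      add_mem' := by
        rintro a b ⟨N, hN⟩ ⟨M, hM⟩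
        refine ⟨max N M, fun n hn X => ?_⟩
        rw [map_add, hN n (le_trans (le_max_left _ _) hn), hM n (le_trans (le_max_right _ _) hn),
          add_zero]
      zero_mem' := ⟨0, fun n _ X => map_zero _⟩
      smul_mem' := by
        rintro c a ⟨N, hN⟩
        refine ⟨N, fun n hn X => ?_⟩
        rw [map_smul, hN n hn, smul_zero] }
  have hW : W = ⊤ := by
    refine J.cyclic W ⟨0, fun n hn X => J.mode_vacuum n hn X⟩ ?_
    rintro m Y w ⟨N, hN⟩
    refine ⟨max N (max (N - m) (1 - m)), fun n hn X => ?_⟩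
    have h1 : N ≤ n := by omega
    have h2 : N ≤ n + m := by omega
    have h3 : ¬ n + m = 0 := by omega
    have h := congrArg (fun T : Module.End ℂ V => T w) (J.comm n m X Y)
    simpa [h3, hN n h1, hN (n + m) h2] using h
  have : v ∈ W := by rw [hW]; trivial
  exact this

theorem finite_support_normalOrderedTerm (X Y : 𝔤) (n : ℤ) (v : V) :
    (Function.support fun m : ℤ => J.normalOrderedTerm X Y n m v).Finite := by
  obtain ⟨N, hN⟩ := J.exists_mode_eq_zero v
  refine (Set.finite_Icc (min (n - N) 0) (max N 0)).subset fun m hm => ?_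
  by_contra hcon
  apply hm
  simp only [Set.mem_Icc, not_and_or, not_le] at hcon
  show J.normalOrderedTerm X Y n m v = 0
  unfold normalOrderedTerm
  split_ifs with h
  · have h1 : N ≤ n - m := by omega
    simp [hN (n - m) h1]
  · have h1 : N ≤ m := by omega
    simp [hN m h1]

/-- The `n`-th mode of `(π / c) g_{ab} :j^{φ(a)} j^{φ(b)}:(x)`, where `φ : S → 𝔤` is linear, the
indices refer to a basis of `S`, and `g_{ab}` is the inverse of the Gram matrix
`g^{ab} = g (e a) (e b)` of the form `g` on `S`. The mode is obtained by smearing with the test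
function `x ↦ ((1 + x ^ 2) / 2) * ((1 + i x) / (1 - i x)) ^ n`. -/
def sugawaraMode {S : Type*} [AddCommGroup S] [Module ℝ S] [FiniteDimensional ℝ S]
    (φ : S →ₗ[ℝ] 𝔤) (g : LinearMap.BilinForm ℝ S) (c : ℝ) (n : ℤ) (v : V) : V :=
  let e := Module.finBasis ℝ S
  let G : Matrix (Fin (Module.finrank ℝ S)) (Fin (Module.finrank ℝ S)) ℝ :=
    Matrix.of fun a b => g (e a) (e b)
  ((1 / (2 * c) : ℝ) : ℂ) •
    ∑ a, ∑ b, ((G⁻¹ a b : ℝ) : ℂ) • J.normalOrderedMode (φ (e a)) (φ (e b)) n v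

/-- The modes of the Sugawara stress-energy tensor `Θ^𝔤` of the current algebra. -/
def stressEnergy (n : ℤ) (v : V) : V :=
  J.sugawaraMode LinearMap.id (normalizedForm 𝔤) (k + dualCoxeterNumber 𝔤) n v

/-- The modes of the Sugawara stress-energy tensor associated with the currents whose colours lie
in the image of a compact simple Lie algebra `S`. -/
def simpleStressEnergy {S : Type*} [LieRing S] [LieAlgebra ℝ S] [FiniteDimensional ℝ S]
    (φ : S →ₗ⁅ℝ⁆ 𝔤) (n : ℤ) (v : V) : V :=
  J.sugawaraMode (φ : S →ₗ[ℝ] 𝔤) (normalizedForm S)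
    (dynkinIndex φ * k + dualCoxeterNumber S) n v

/-- The modes of the Sugawara stress-energy tensor associated with the currents whose colours lie
in the image of an abelian Lie algebra `S`: here the Dynkin index is set to `1`, the dual Coxeter
number to `0`, and the form on `S` is the restriction of the form on `𝔤`. -/
def abelianStressEnergy {S : Type*} [LieRing S] [LieAlgebra ℝ S] [FiniteDimensional ℝ S]
    (φ : S →ₗ⁅ℝ⁆ 𝔤) (n : ℤ) (v : V) : V :=
  J.sugawaraMode (φ : S →ₗ[ℝ] 𝔤)
    ((normalizedForm 𝔤).compl₁₂ (φ : S →ₗ[ℝ] 𝔤) (φ : S →ₗ[ℝ] 𝔤)) (1 * k + 0) n v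

variable {𝔥 : Type*} [LieRing 𝔥] [LieAlgebra ℝ 𝔥] [FiniteDimensional ℝ 𝔥]

/-- The modes of the stress-energy tensor `Θ^𝔥`, the sum of the stress-energy tensors of the simple
ideals and of the centre of the reductive Lie algebra `𝔥`. -/
def subStressEnergy (ι : 𝔥 →ₗ⁅ℝ⁆ 𝔤) (n : ℤ) (v : V) : V :=
  (∑ᶠ I : {I : LieIdeal ℝ 𝔥 // LieAlgebra.IsSimple ℝ I},
      J.simpleStressEnergy (ι.comp (LieIdeal.incl I.1)) n v) +
    J.abelianStressEnergy (ι.comp (LieIdeal.incl (LieAlgebra.center ℝ 𝔥))) n v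

/-- The embedding `ι` of `𝔥` into `𝔤` yields a conformal inclusion of the associated current
algebras: `Θ^𝔥 = Θ^𝔤`. -/
def IsConformalInclusion (ι : 𝔥 →ₗ⁅ℝ⁆ 𝔤) : Prop :=
  ∀ (n : ℤ) (v : V), J.subStressEnergy ι n v = J.stressEnergy n v

end CurrentAlgebra

end ConformalInclusion

end

namespace ConformalInclusion

open scoped TensorProduct
open LieAlgebra LieAlgebra.IsKilling LieModule Module

/-! ### Strings of weight vectors under an sl₂-triple -/

section Sl2

variable {L M : Type*} [LieRing L] [LieAlgebra ℂ L] [AddCommGroup M] [Module ℂ M]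
  [LieRingModule L M] [LieModule ℂ L M] {h e f : L}

/-! Apply Θ^𝔥 = Θ^𝔤 to the vacuum in mode −2. Both sides are images of tensors under X ⊗ Y ↦ j₋₁(X)
j₋₁(Y) Ω, and the invariant form turns tensors into operators on 𝔤. Θ^𝔤 gives a nonzero multiple of
1; Θ^𝔥 gives a symmetric operator with range in ι(𝔥). Their difference A is symmetric, nonzero
because ι(𝔥) ≠ 𝔤, and has zero image in V. Pairing that image with j₋₁(Z) j₋₁(W) Ω
(`smulRight_mem_gramGraph`) yields −tr(ad W A ad Z) = (k/v) κ(AZ, W): A is an eigenvector, with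
eigenvalue k/v, of T : A ↦ −∑ ad xᵢ A ad xⁱ, for dual bases with respect to κ.

It remains to bound such an eigenvalue μ by 1/v. After complexification T commutes with the Lie
algebra action, so its eigenspace contains a highest weight vector, again called A. Take x of weight
β with y = Ax ≠ 0, of weight α, and w of weight −α with κ(y, w) ≠ 0. The trace of ad w A ad x is
computed weight space by weight space (`re_le_of_highest_weight`). The Cartan subalgebra contributes
κ(y, w)(α, β). As A commutes with positive root vectors, the root spaces contribute partial Casimir
sums ∑ f e acting on y and on x, which are nonnegative scalars by sl₂ theory. Hence μ ≤ −(α, β) ≤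
1/v, since no root has squared Killing length above 1/v. -/

theorem exists_nat_of_lie_f_lie_e (t : IsSl2Triple h e f) (N : ℕ) :
    ∀ {x : M} {m c : ℂ}, x ≠ 0 → ⁅h, x⁆ = m • x → ⁅f, ⁅e, x⁆⁆ = c • x →
      (toEnd ℂ L M e ^ N) x = 0 → ∃ q : ℕ, c = q * (m + q + 1) := by
  induction N with
  | zero => intro x m c hx _ _ h0; simp at h0; exact absurd h0 hx
  | succ N ih =>
    intro x m c hx hh hfe hN
    by_cases hex : ⁅e, x⁆ = 0
    · refine ⟨0, ?_⟩
      rw [hex, lie_zero, eq_comm, smul_eq_zero] at hfe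
      simpa [hx] using hfe
    · have h1 : ⁅h, ⁅e, x⁆⁆ = (m + 2) • ⁅e, x⁆ := by
        rw [leibniz_lie, t.lie_h_e_smul ℂ, hh, lie_smul, smul_lie, add_smul, add_comm]
      have h2 : ⁅f, ⁅e, ⁅e, x⁆⁆⁆ = (c - m - 2) • ⁅e, x⁆ := by
        have := leibniz_lie e f ⁅e, x⁆
        rw [t.lie_e_f, hfe, h1, lie_smul] at this
        rw [sub_sub, sub_smul, this]; abel
      obtain ⟨q, hq⟩ := ih hex h1 h2 (by rwa [pow_succ, Module.End.mul_apply] at hN)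
      -- The number `q` counts the steps from `x` to the top of its `e`-string; `⁅e, x⁆` has weight
      -- `m + 2` and is one step nearer.
      refine ⟨q + 1, ?_⟩
      push_cast
      linear_combination hq

theorem exists_nonneg_of_lie_f_lie_e (t : IsSl2Triple h e f) {x : M} {m : ℝ} {c : ℂ}
    (hx : x ≠ 0) (hh : ⁅h, x⁆ = (m : ℂ) • x) (hfe : ⁅f, ⁅e, x⁆⁆ = c • x)
    (he : IsNilpotent (toEnd ℂ L M e)) (hf : IsNilpotent (toEnd ℂ L M f)) :
    ∃ r : ℝ, 0 ≤ r ∧ c = r := by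
  obtain ⟨N, hN⟩ := he
  obtain ⟨N', hN'⟩ := hf
  rcases le_total 0 m with hm | hm
  · obtain ⟨q, hq⟩ := exists_nat_of_lie_f_lie_e t N hx hh hfe (by rw [hN]; rfl)
    exact ⟨q * (m + q + 1), by positivity, by push_cast; exact hq⟩
  -- For negative weight, walk down instead: exchange `e` and `f`, using that `e f` and `f e` differ
  -- by `h`.
  · have h1 : ⁅-h, x⁆ = ((-m : ℝ) : ℂ) • x := by rw [neg_lie, hh]; simp
    have h2 : ⁅e, ⁅f, x⁆⁆ = (c + m) • x := by
      rw [leibniz_lie e f, t.lie_e_f, hh, hfe, add_smul, add_comm]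
    obtain ⟨q, hq⟩ := exists_nat_of_lie_f_lie_e t.symm N' hx h1 h2 (by rw [hN']; rfl)
    refine ⟨-m + q * (-m + q + 1), ?_, ?_⟩
    · have : 0 ≤ -m := by linarith
      positivity
    · push_cast at hq ⊢
      linear_combination hq

end Sl2

/-! ### Highest weight vectors and Killing lengths of coroots -/

section HighestWeight

variable {L : Type*} [LieRing L] [LieAlgebra ℂ L] [FiniteDimensional ℂ L]
  {H : LieSubalgebra ℂ L} [H.IsCartanSubalgebra]

/-- The sign of such a generic functional plays the role of a choice of positive roots. -/
theorem exists_real_dual_forall_root_ne_zero :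
    ∃ ψ : Dual ℂ H →ₗ[ℝ] ℝ, ∀ γ : Weight ℂ H L, γ.IsNonZero → ψ γ.toLinear ≠ 0 := by
  obtain ⟨ψ, hψ⟩ := Module.exists_dual_forall_apply_ne_zero (K := ℝ) (M := Dual ℂ H)
    (fun γ : {γ : Weight ℂ H L // γ.IsNonZero} ↦ γ.1.toLinear)
    fun γ ↦ Weight.coe_toLinear_ne_zero_iff.2 γ.2
  exact ⟨ψ, fun γ hγ ↦ hψ ⟨γ, hγ⟩⟩

/-- A weight maximising `ψ` cannot be raised by a root on which `ψ` is positive. -/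
theorem exists_highest_weight_vector (M : Type*) [AddCommGroup M] [Module ℂ M]
    [LieRingModule L M] [LieModule ℂ L M] [FiniteDimensional ℂ M] [Nontrivial M]
    (ψ : Dual ℂ H →ₗ[ℝ] ℝ) :
    ∃ (l : H → ℂ) (m : M), m ≠ 0 ∧ (∀ h : H, ⁅h, m⁆ = l h • m) ∧
      ∀ γ : Weight ℂ H L, 0 < ψ γ.toLinear → ∀ e ∈ rootSpace H γ, ⁅e, m⁆ = 0 := by
  have : Nonempty (Weight ℂ H M) := by
    by_contra! contra
    simpa only [iSup_of_empty, bot_ne_top] using LieModule.iSup_genWeightSpace_eq_top' ℂ H M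
  obtain ⟨χ, hχ⟩ := Finite.exists_max fun χ : Weight ℂ H M ↦ ψ χ.toLinear
  obtain ⟨m, hm, hm'⟩ := exists_forall_lie_eq_smul ℂ H M χ
  refine ⟨χ, m, hm, hm', fun γ hγ e he ↦ ?_⟩
  have hmem : m ∈ genWeightSpace M χ :=
    weightSpace_le_genWeightSpace M χ ((mem_weightSpace χ m).2 hm')
  have h1 := lie_mem_genWeightSpace_of_mem_genWeightSpace he hmem
  by_contra h0
  let χ' : Weight ℂ H M := ⟨γ + χ, fun h ↦ h0 (by rw [h] at h1; simpa using h1)⟩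
  have h2 : χ'.toLinear = γ.toLinear + χ.toLinear := rfl
  have h3 := hχ χ'
  rw [h2, map_add] at h3
  linarith

variable [IsKilling ℂ L]

theorem killingForm_coe_coe_eq_sum (x y : H) :
    killingForm ℂ L x y = ∑ β ∈ H.root, β x * β y := by
  have h1 : killingForm ℂ L x y = _ :=
    congr($(restrict_killingForm_eq_sum (K := ℂ) (L := L) (H := H)) x y)
  rw [h1]
  simp only [LinearMap.coe_sum, Finset.sum_apply, LinearMap.smulRight_apply,
    LinearMap.smul_apply, smul_eq_mul, Weight.toLinear_apply]

/-- The value is the sum of the squares of the integers β(αᵛ) over all roots β; the roots ±α alone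
contribute 4 + 4. -/
theorem exists_real_killingForm_coroot (α : Weight ℂ H L) (hα : α.IsNonZero) :
    ∃ q : ℝ, 8 ≤ q ∧ killingForm ℂ L (coroot α : H) (coroot α : H) = q := by
  classical
  refine ⟨∑ β ∈ H.root, ((chainBotCoeff α β - chainTopCoeff α β : ℤ) : ℝ) ^ 2, ?_, ?_⟩
  · have hmem : ∀ β : Weight ℂ H L, β.IsNonZero → β ∈ H.root := by
      intro β hβ; simpa [LieSubalgebra.root] using hβ
    have hne : α ≠ -α := by
      intro h
      have h2 := root_apply_coroot hα
      rw [h] at h2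
      simp [-coroot_neg] at h2
      rw [← h, root_apply_coroot hα] at h2
      norm_num at h2
    have hsub : ({α, -α} : Finset (Weight ℂ H L)) ⊆ H.root := by
      intro β hβ
      simp only [Finset.mem_insert, Finset.mem_singleton] at hβ
      rcases hβ with rfl | rfl
      · exact hmem _ hα
      · exact hmem _ hα.neg
    refine le_trans ?_ (Finset.sum_le_sum_of_subset_of_nonneg hsub fun _ _ _ ↦ sq_nonneg _)
    rw [Finset.sum_pair hne]
    have h2 : ((chainBotCoeff α α - chainTopCoeff α α : ℤ) : ℂ) = 2 := by
      rw [← apply_coroot_eq_cast, root_apply_coroot hα]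
    have h3 : ((chainBotCoeff α (-α) - chainTopCoeff α (-α) : ℤ) : ℂ) = -2 := by
      rw [← apply_coroot_eq_cast, Weight.coe_neg, Pi.neg_apply, root_apply_coroot hα]
    have h2' : (chainBotCoeff α α - chainTopCoeff α α : ℤ) = 2 := by exact_mod_cast h2
    have h3' : (chainBotCoeff α (-α) - chainTopCoeff α (-α) : ℤ) = -2 := by exact_mod_cast h3
    rw [h2', h3']; norm_num
  · rw [killingForm_coe_coe_eq_sum]
    push_cast
    refine Finset.sum_congr rfl fun β _ ↦ ?_
    rw [apply_coroot_eq_cast]; push_cast; ring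

end HighestWeight

/-! ### Normalised root vectors, partial Casimir sums and root lengths -/

section RootVectors

variable {L : Type*} [LieRing L] [LieAlgebra ℂ L] {H : LieSubalgebra ℂ L} [H.IsCartanSubalgebra]

theorem lie_lie_mem_rootSpace {χ α : Weight ℂ H L} {e f y : L} (he : e ∈ rootSpace H χ)
    (hf : f ∈ rootSpace H (-χ)) (hy : y ∈ rootSpace H α) : ⁅f, ⁅e, y⁆⁆ ∈ rootSpace H α := by
  have := lie_mem_genWeightSpace_of_mem_genWeightSpace hf
    (lie_mem_genWeightSpace_of_mem_genWeightSpace he hy)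
  rwa [neg_add_cancel_left] at this

variable [FiniteDimensional ℂ L] [IsKilling ℂ L]

theorem killingForm_cartanEquivDual_symm (α : Dual ℂ H) (x : H) :
    killingForm ℂ L ((cartanEquivDual H).symm α : H) x = α x :=
  congr($((cartanEquivDual H).apply_symm_apply α) x)

theorem eq_smul_of_mem_rootSpace {α : Weight ℂ H L} (hα : α.IsNonZero) {x y : L}
    (hx : x ∈ rootSpace H α) (hx0 : x ≠ 0) (hy : y ∈ rootSpace H α) : ∃ c : ℂ, y = c • x := by
  obtain ⟨c, hc⟩ := (finrank_eq_one_iff_of_nonzero' (⟨x, hx⟩ : rootSpace H α)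
    (by simpa [LieSubmodule.mk_eq_zero] using hx0)).1 (finrank_rootSpace_eq_one α hα) ⟨y, hy⟩
  exact ⟨c, by simpa using congr_arg Subtype.val hc.symm⟩

theorem exists_root_vectors (χ : Weight ℂ H L) (hχ : χ.IsNonZero) :
    ∃ e ∈ rootSpace H χ, ∃ f ∈ rootSpace H (-χ), killingForm ℂ L e f = 1 ∧
      ∀ α : Weight ℂ H L, α.IsNonZero → ∀ y ∈ rootSpace H α,
        ∃ r : ℝ, 0 ≤ r ∧ ⁅f, ⁅e, y⁆⁆ = (r : ℂ) • y := by
  obtain ⟨h, e, f, t, he, hf⟩ := exists_isSl2Triple_of_weight_isNonZero hχ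
  have hh := t.h_eq_coroot hχ he hf
  obtain ⟨q, hq, hq'⟩ := exists_real_killingForm_coroot χ hχ
  have hs : killingForm ℂ L e f = (q / 2 : ℝ) := by
    have h1 := lie_eq_killingForm_smul_of_mem_rootSpace_of_mem_rootSpace_neg he hf
    rw [t.lie_e_f, hh] at h1
    have h2 := congr(killingForm ℂ L $h1 (coroot χ : H))
    rw [map_smul, LinearMap.smul_apply, killingForm_cartanEquivDual_symm, hq',
      Weight.toLinear_apply, root_apply_coroot hχ, smul_eq_mul] at h2
    push_cast
    rw [h2]; ring
  have hq0 : (0 : ℝ) < q := by linarith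
  have hqc : (q : ℂ) ≠ 0 := by exact_mod_cast hq0.ne'
  -- In an sl₂-triple κ(e, f) = κ(αᵛ, αᵛ)/2 = q/2, hence the rescaling by 2/q.
  refine ⟨e, he, ((2 / q : ℝ) : ℂ) • f, Submodule.smul_mem _ _ hf, ?_, fun α hα y hy ↦ ?_⟩
  · rw [map_smul, hs, smul_eq_mul]
    push_cast; field_simp
  · by_cases hy0 : y = 0
    · exact ⟨0, le_rfl, by simp [hy0]⟩
    obtain ⟨c, hc⟩ := eq_smul_of_mem_rootSpace hα hy hy0 (lie_lie_mem_rootSpace he hf hy)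
    have hm : ⁅h, y⁆ = (((chainBotCoeff χ α - chainTopCoeff χ α : ℤ) : ℝ) : ℂ) • y := by
      rw [hh]
      refine (lie_eq_smul_of_mem_rootSpace hy (coroot χ)).trans ?_
      rw [apply_coroot_eq_cast]; norm_cast
    obtain ⟨r, hr, rfl⟩ := exists_nonneg_of_lie_f_lie_e t hy0 hm hc
      (isNilpotent_ad_of_mem_rootSpace H hχ he)
      (isNilpotent_ad_of_mem_rootSpace H hχ.neg hf)
    refine ⟨2 / q * r, by positivity, ?_⟩
    rw [smul_lie, hc, smul_smul]; push_cast; rfl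

theorem sum_root_filter_pos (ψ : Dual ℂ H →ₗ[ℝ] ℝ)
    (hψ : ∀ γ : Weight ℂ H L, γ.IsNonZero → ψ γ.toLinear ≠ 0) (x y : H) :
    ∑ χ : Weight ℂ H L with 0 < ψ χ.toLinear, χ x * χ y =
      (2 : ℂ)⁻¹ * killingForm ℂ L x y := by
  classical
  have h0 : ∀ χ : Weight ℂ H L, 0 < ψ χ.toLinear → χ.IsNonZero := fun χ h h' ↦ by
    rw [Weight.coe_toLinear_eq_zero_iff.2 h', map_zero] at h; exact h.false
  have h1 : ∑ χ : Weight ℂ H L with ψ χ.toLinear < 0, χ x * χ y =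
      ∑ χ : Weight ℂ H L with 0 < ψ χ.toLinear, χ x * χ y := by
    refine Finset.sum_bij' (fun χ _ ↦ -χ) (fun χ _ ↦ -χ) ?_ ?_ ?_ ?_ ?_ <;> simp
  have h2 : killingForm ℂ L x y = ∑ χ : Weight ℂ H L with 0 < ψ χ.toLinear, χ x * χ y +
      ∑ χ : Weight ℂ H L with ψ χ.toLinear < 0, χ x * χ y := by
    rw [killingForm_coe_coe_eq_sum, ← Finset.sum_union]
    · refine Finset.sum_congr ?_ fun _ _ ↦ rfl
      ext χ
      simp only [LieSubalgebra.root, Finset.mem_filter, Finset.mem_univ, true_and,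
        Finset.mem_union]
      refine ⟨fun h ↦ (lt_or_gt_of_ne (hψ χ h)).symm, ?_⟩
      rintro (h | h)
      · exact h0 χ h
      · have := h0 (-χ) (by simpa using h)
        simpa using this
    · rw [Finset.disjoint_filter]
      exact fun _ _ h h' ↦ lt_asymm h h'
  rw [h2, h1]; ring

/-- This is the half of the Casimir operator belonging to the positive roots. On a root space each
summand is a nonnegative scalar. On the Cartan subalgebra only the whole sum is scalar: it sends y
to ∑ χ(y) t_χ, and the positive roots carry half of the Killing form, whence 1/2. -/
theorem exists_sum_lie_lie_eq_smul (ψ : Dual ℂ H →ₗ[ℝ] ℝ)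
    (hψ : ∀ γ : Weight ℂ H L, γ.IsNonZero → ψ γ.toLinear ≠ 0) (e f : Weight ℂ H L → L)
    (he : ∀ χ : Weight ℂ H L, χ.IsNonZero → e χ ∈ rootSpace H χ) 
    (hf : ∀ χ : Weight ℂ H L, χ.IsNonZero → f χ ∈ rootSpace H (-χ))
    (hef : ∀ χ : Weight ℂ H L, χ.IsNonZero → killingForm ℂ L (e χ) (f χ) = 1)
    (hpos : ∀ χ : Weight ℂ H L, χ.IsNonZero → ∀ α : Weight ℂ H L, α.IsNonZero → ∀ y ∈ rootSpace H α,
        ∃ r : ℝ, 0 ≤ r ∧ ⁅f χ, ⁅e χ, y⁆⁆ = (r : ℂ) • y)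
    (α : Weight ℂ H L) (y : L) (hy : y ∈ rootSpace H α) :
    ∃ r : ℝ, 0 ≤ r ∧
      ∑ χ : Weight ℂ H L with 0 < ψ χ.toLinear, ⁅f χ, ⁅e χ, y⁆⁆ = (r : ℂ) • y := by
  have h0 : ∀ χ : Weight ℂ H L, 0 < ψ χ.toLinear → χ.IsNonZero := fun χ h h' ↦ by
    rw [Weight.coe_toLinear_eq_zero_iff.2 h', map_zero] at h; exact h.false
  by_cases hα : α.IsZero
  · refine ⟨2⁻¹, by positivity, ?_⟩
    rw [hα.eq, rootSpace_zero_eq] at hy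
    lift y to H using hy
    have h1 : ∀ χ ∈ Finset.univ.filter fun χ : Weight ℂ H L ↦ 0 < ψ χ.toLinear,
        ⁅f χ, ⁅e χ, (y : L)⁆⁆ = ((χ y • (cartanEquivDual H).symm χ.toLinear : H) : L) := by
      intro χ hχ
      have hχ' := h0 χ (by simpa using hχ)
      have h2 : ⁅(y : L), e χ⁆ = χ y • e χ := lie_eq_smul_of_mem_rootSpace (he χ hχ') y
      have h3 := lie_eq_killingForm_smul_of_mem_rootSpace_of_mem_rootSpace_neg
        (he χ hχ') (hf χ hχ')
      rw [hef χ hχ', one_smul] at h3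
      rw [← lie_skew (e χ) (y : L), h2, lie_neg, lie_smul, ← smul_neg, lie_skew, h3]; rfl
    rw [Finset.sum_congr rfl h1]
    have h4 : ∑ χ : Weight ℂ H L with 0 < ψ χ.toLinear,
        χ y • (cartanEquivDual H).symm χ.toLinear = ((2⁻¹ : ℝ) : ℂ) • y := by
      apply (cartanEquivDual H).injective
      ext z
      rw [map_sum]
      simp only [map_smul, LinearEquiv.apply_symm_apply, LinearMap.coe_sum, Finset.sum_apply,
        LinearMap.smul_apply, smul_eq_mul, Weight.toLinear_apply]
      rw [sum_root_filter_pos ψ hψ]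
      push_cast; rfl
    exact_mod_cast congr(($h4 : L))
  · choose! r hr hr' using hpos
    refine ⟨∑ χ : Weight ℂ H L with 0 < ψ χ.toLinear, r χ α y, ?_, ?_⟩
    · exact Finset.sum_nonneg fun χ hχ ↦ hr χ (h0 χ (by simpa using hχ)) α hα y hy
    · push_cast
      rw [Finset.sum_smul]
      exact Finset.sum_congr rfl fun χ hχ ↦ hr' χ (h0 χ (by simpa using hχ)) α hα y hy

theorem exists_cartanEquivDual_symm_eq_smul_coroot (α : Weight ℂ H L) (hα : α.IsNonZero) :
    ∃ q : ℝ, 8 ≤ q ∧ killingForm ℂ L (coroot α : H) (coroot α : H) = q ∧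
      (cartanEquivDual H).symm α.toLinear = ((2 / q : ℝ) : ℂ) • coroot α := by
  obtain ⟨q, hq, hq'⟩ := exists_real_killingForm_coroot α hα
  refine ⟨q, hq, hq', ?_⟩
  have hq0 : (q : ℂ) ≠ 0 := by
    have : (0 : ℝ) < q := by linarith
    exact_mod_cast this.ne'
  have ha := root_apply_cartanEquivDual_symm_ne_zero hα
  set t := (cartanEquivDual H).symm α.toLinear with ht
  have h1 : coroot α = (2 * (α t)⁻¹) • t := by
    rw [mul_smul, ofNat_smul_eq_nsmul]; rfl
  have h2 : (q : ℂ) = 4 * (α t)⁻¹ := by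
    have h3 : killingForm ℂ L (coroot α : H) (coroot α : H) =
        (2 * (α t)⁻¹) * killingForm ℂ L t (coroot α : H) := by
      have h4 : (coroot α : L) = (2 * (α t)⁻¹) • (t : L) := congr_arg Subtype.val h1
      have h5 := congr(killingForm ℂ L $h4 (coroot α : H))
      rwa [map_smul, LinearMap.smul_apply, smul_eq_mul] at h5
    rw [← hq', h3, ht, killingForm_cartanEquivDual_symm, Weight.toLinear_apply,
      root_apply_coroot hα]
    ring
  rw [h1, smul_smul]
  push_cast
  have : (2 / (q : ℂ) * (2 * (α t)⁻¹)) = 1 := by rw [h2]; field_simp; norm_num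
  rw [this, one_smul]

theorem exists_real_apply_cartanEquivDual_symm (α β : Weight ℂ H L) :
    ∃ r : ℝ, β ((cartanEquivDual H).symm α.toLinear) = r := by
  by_cases hα : α.IsZero
  · exact ⟨0, by rw [Weight.coe_toLinear_eq_zero_iff.2 hα, map_zero, ← Weight.toLinear_apply,
      map_zero, Complex.ofReal_zero]⟩
  obtain ⟨q, -, -, h⟩ := exists_cartanEquivDual_symm_eq_smul_coroot α hα
  refine ⟨2 / q * (chainBotCoeff α β - chainTopCoeff α β : ℤ), ?_⟩
  rw [h, ← Weight.toLinear_apply, map_smul, Weight.toLinear_apply, apply_coroot_eq_cast]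
  push_cast; rfl

/-- The Killing form is positive on the real span of the vectors t_α dual to the roots, so −2(α, β)
≤ |α|² + |β|², and |α|² = 4/κ(αᵛ, αᵛ) ≤ 4/c. The zero weight is admitted because `x` or `A x` may
lie in the Cartan subalgebra. -/
theorem neg_re_killingForm_le {c : ℝ} (hc : 0 < c)
    (hroot : ∀ α : Weight ℂ H L, α.IsNonZero →
      c ≤ (killingForm ℂ L (coroot α : H) (coroot α : H)).re) (α β : Weight ℂ H L) :
    -(killingForm ℂ L ((cartanEquivDual H).symm α.toLinear : H)
      ((cartanEquivDual H).symm β.toLinear : H)).re ≤ 4 / c := by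
  have key : ∀ α : Weight ℂ H L, (killingForm ℂ L ((cartanEquivDual H).symm α.toLinear : H)
      ((cartanEquivDual H).symm α.toLinear : H)).re ≤ 4 / c := by
    intro α
    by_cases hα : α.IsZero
    · rw [Weight.coe_toLinear_eq_zero_iff.2 hα, map_zero]
      simp only [ZeroMemClass.coe_zero, map_zero, Complex.zero_re]
      positivity
    obtain ⟨q, hq, hq', h⟩ := exists_cartanEquivDual_symm_eq_smul_coroot α hα
    have h1 := hroot α hα
    rw [hq', Complex.ofReal_re] at h1
    rw [killingForm_cartanEquivDual_symm, h, map_smul, Weight.toLinear_apply,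
      root_apply_coroot hα]
    have : ((2 / q : ℝ) : ℂ) • (2 : ℂ) = ((4 / q : ℝ) : ℂ) := by
      rw [smul_eq_mul]; push_cast; ring
    rw [this, Complex.ofReal_re]
    gcongr
  set s := (cartanEquivDual H).symm α.toLinear with hs
  set t := (cartanEquivDual H).symm β.toLinear with ht
  have hpos : 0 ≤ (killingForm ℂ L ((s + t : H) : L) ((s + t : H) : L)).re := by
    rw [killingForm_coe_coe_eq_sum, Complex.re_sum]
    refine Finset.sum_nonneg fun γ _ ↦ ?_
    obtain ⟨a, ha⟩ := exists_real_apply_cartanEquivDual_symm α γ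
    obtain ⟨b, hb⟩ := exists_real_apply_cartanEquivDual_symm β γ
    rw [← Weight.toLinear_apply, map_add, Weight.toLinear_apply, Weight.toLinear_apply, ha, hb]
    norm_cast
    exact mul_self_nonneg _
  have h1 : killingForm ℂ L (t : L) (s : L) = killingForm ℂ L (s : L) (t : L) :=
    traceForm_comm ℂ L L _ _
  simp only [AddMemClass.coe_add, map_add, LinearMap.add_apply, Complex.add_re, h1] at hpos
  have := key α
  have := key β
  linarith

end RootVectors

/-! ### The trace computation for a highest weight vector -/

section Trace

variable {L : Type*} [LieRing L] [LieAlgebra ℂ L] [FiniteDimensional ℂ L] [IsKilling ℂ L]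
  {H : LieSubalgebra ℂ L} [H.IsCartanSubalgebra]

theorem trace_restrict_rootSpace {χ : Weight ℂ H L} (hχ : χ.IsNonZero) {e f : L}
    (he : e ∈ rootSpace H χ) (hef : killingForm ℂ L e f = 1) (B : End ℂ L)
    (hB : Set.MapsTo B (rootSpace H χ).toSubmodule (rootSpace H χ).toSubmodule) :
    LinearMap.trace ℂ (rootSpace H χ).toSubmodule (B.restrict hB) = killingForm ℂ L (B e) f := by
  have h1 : finrank ℂ (rootSpace H χ).toSubmodule = 1 := finrank_rootSpace_eq_one χ hχ
  obtain ⟨c, hc, -⟩ := LinearMap.existsUnique_eq_smul_id_of_finrank_eq_one h1 (B.restrict hB)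
  change B.restrict hB = c • LinearMap.id at hc
  have h2 : B e = c • e := congr_arg Subtype.val congr($hc ⟨e, he⟩)
  rw [hc, h2, map_smul, map_smul, LinearMap.smul_apply, LinearMap.trace_id, h1, hef]
  simp

theorem trace_eq_of_weight_zero (B : End ℂ L) (u v : H) (κ : ℂ)
    (hB : ∀ χ : Weight ℂ H L,
      Set.MapsTo B (rootSpace H χ).toSubmodule (rootSpace H χ).toSubmodule)
    (hB0 : ∀ z : H, B z = (κ * killingForm ℂ L u z) • (v : L)) (e f : Weight ℂ H L → L)
    (he : ∀ χ : Weight ℂ H L, χ.IsNonZero → e χ ∈ rootSpace H χ)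
    (hef : ∀ χ : Weight ℂ H L, χ.IsNonZero → killingForm ℂ L (e χ) (f χ) = 1) :
    LinearMap.trace ℂ L B = κ * killingForm ℂ L u v +
      ∑ χ : Weight ℂ H L with χ.IsNonZero, killingForm ℂ L (B (e χ)) (f χ) := by
  classical
  have hds := DirectSum.isInternal_submodule_of_iSupIndep_of_iSup_eq_top
    (LieSubmodule.iSupIndep_toSubmodule.mpr <| iSupIndep_genWeightSpace' ℂ H L)
    (LieSubmodule.iSup_toSubmodule_eq_top.mpr <| iSup_genWeightSpace_eq_top' ℂ H L)
  rw [LinearMap.trace_eq_sum_trace_restrict hds hB,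
    ← Finset.sum_filter_add_sum_filter_not (p := fun χ : Weight ℂ H L ↦ χ.IsNonZero), add_comm]
  congr 1
  -- Zero is a weight only when `L` is nontrivial; then its space is the Cartan subalgebra, where
  -- `B` has rank at most one.
  · rcases subsingleton_or_nontrivial L with hL | hL
    · rw [Finset.sum_eq_zero, Subsingleton.elim (v : L) 0, map_zero, mul_zero]
      exact fun χ _ ↦ absurd (Subsingleton.elim _ _) χ.genWeightSpace_ne_bot
    have h0 : (Finset.univ.filter fun χ : Weight ℂ H L ↦ ¬ χ.IsNonZero) = {0} := by
      ext χ
      simp [Weight.isNonZero_iff_ne_zero]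
    have hmem : ∀ z : L, z ∈ rootSpace H (0 : Weight ℂ H L) ↔ z ∈ H := by
      intro z
      rw [Weight.isZero_zero.eq, rootSpace_zero_eq, LieSubalgebra.mem_toLieSubmodule]
    rw [h0, Finset.sum_singleton]
    have h1 : B.restrict (hB 0) = (κ • (killingForm ℂ L u).comp
        (rootSpace H (0 : Weight ℂ H L)).toSubmodule.subtype).smulRight
          (⟨v, (hmem v).2 v.2⟩ : (rootSpace H (0 : Weight ℂ H L)).toSubmodule) := by
      ext z
      exact hB0 ⟨z, (hmem z).1 z.2⟩
    rw [h1, LinearMap.trace_smulRight]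
    rfl
  · exact Finset.sum_congr rfl fun χ hχ ↦
      trace_restrict_rootSpace (by simpa using hχ) (he χ (by simpa using hχ))
        (hef χ (by simpa using hχ)) B (hB χ)

theorem map_mem_rootSpace {A : End ℂ L} {l : H → ℂ}
    (hA : ∀ (h : H) (u : L), ⁅(h : L), A u⁆ = l h • A u + A ⁅(h : L), u⁆)
    {χ : H → ℂ} {u : L} (hu : u ∈ rootSpace H χ) : A u ∈ rootSpace H (l + χ) := by
  refine weightSpace_le_genWeightSpace L (l + χ) ((mem_weightSpace (l + χ) (A u)).2 fun h ↦ ?_)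
  have h1 : ⁅(h : L), u⁆ = χ h • u := lie_eq_smul_of_mem_rootSpace hu h
  refine (hA h u).trans ?_
  rw [h1, map_smul, ← add_smul]; rfl

/-- An eigenvalue of the operator `A ↦ -∑ᵢ ad xᵢ ∘ A ∘ ad xⁱ` (for dual bases `xᵢ`, `xⁱ` with
respect to the Killing form) on a highest weight vector in the endomorphisms of `L`. -/
theorem re_le_of_highest_weight {c : ℝ} (hc : 0 < c)
    (hroot : ∀ α : Weight ℂ H L, α.IsNonZero →
      c ≤ (killingForm ℂ L (coroot α : H) (coroot α : H)).re)
    (ψ : Dual ℂ H →ₗ[ℝ] ℝ) (hψ : ∀ γ : Weight ℂ H L, γ.IsNonZero → ψ γ.toLinear ≠ 0)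
    {A : End ℂ L} (hA0 : A ≠ 0) {μ : ℂ}
    (hμ : ∀ z w : L, -LinearMap.trace ℂ L (ad ℂ L w ∘ₗ A ∘ₗ ad ℂ L z) =
      μ * killingForm ℂ L (A z) w) {l : H → ℂ}
    (hA : ∀ (h : H) (u : L), ⁅(h : L), A u⁆ = l h • A u + A ⁅(h : L), u⁆)
    (hpos : ∀ γ : Weight ℂ H L, 0 < ψ γ.toLinear → ∀ e ∈ rootSpace H γ, ∀ u : L,
      ⁅e, A u⁆ = A ⁅e, u⁆) : μ.re ≤ 4 / c := by
  classical
  obtain ⟨β, x, hx, hAx⟩ : ∃ (β : Weight ℂ H L) (x : L), x ∈ rootSpace H β ∧ A x ≠ 0 := by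
    by_contra! hcon
    apply hA0
    have : ⨆ χ : Weight ℂ H L, (rootSpace H χ).toSubmodule ≤ LinearMap.ker A :=
      iSup_le fun χ z hz ↦ hcon χ z hz
    rw [LieSubmodule.iSup_toSubmodule_eq_top.mpr (iSup_genWeightSpace_eq_top' ℂ H L),
      top_le_iff, LinearMap.ker_eq_top] at this
    exact this
  set y := A x with hy
  have hyα' : y ∈ rootSpace H (l + β) := map_mem_rootSpace hA hx
  let α : Weight ℂ H L := ⟨l + β, fun h ↦ hAx ((LieSubmodule.mem_bot y).1 (h.le hyα'))⟩
  have hyα : y ∈ rootSpace H α := hyα'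
  obtain ⟨w, hw, hyw⟩ : ∃ w ∈ rootSpace H (-α), killingForm ℂ L y w ≠ 0 := by
    by_contra! hcon
    have h1 := mem_ker_killingForm_of_mem_rootSpace_of_forall_rootSpace_neg ℂ L H hyα hcon
    rw [ker_killingForm_eq_bot] at h1
    exact hAx ((Submodule.mem_bot ℂ).1 h1)
  choose! e he f hf hef hr using fun (χ : Weight ℂ H L) (hχ : χ.IsNonZero) ↦
    exists_root_vectors χ hχ
  set B : End ℂ L := ad ℂ L w ∘ₗ A ∘ₗ ad ℂ L x with hBdef
  have hBapp : ∀ z, B z = ⁅w, A ⁅x, z⁆⁆ := fun z ↦ rfl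
  have hyw' := lie_eq_killingForm_smul_of_mem_rootSpace_of_mem_rootSpace_neg hyα hw
  -- `B` has weight −α + l + β = 0. On the Cartan subalgebra it sends z to β(z)[y, w] = β(z) κ(y, w)
  -- t_α.
  have htr := trace_eq_of_weight_zero B ((cartanEquivDual H).symm β.toLinear)
    ((cartanEquivDual H).symm α.toLinear) (killingForm ℂ L y w) (fun χ z hz ↦ by
      have h1 := lie_mem_genWeightSpace_of_mem_genWeightSpace hw
        (map_mem_rootSpace hA (lie_mem_genWeightSpace_of_mem_genWeightSpace hx hz))
      have h2 : -(α : H → ℂ) + (l + (β + χ)) = χ := by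
        change -(l + (β : H → ℂ)) + (l + (β + χ)) = χ
        abel
      rwa [h2] at h1) (fun z ↦ by
      have h1 : ⁅(z : L), x⁆ = β z • x := lie_eq_smul_of_mem_rootSpace hx z
      rw [hBapp, ← lie_skew x (z : L), h1, map_neg, map_smul, ← hy, lie_neg, lie_smul, ← smul_neg, lie_skew,
        hyw', smul_smul, killingForm_cartanEquivDual_symm, mul_comm]; rfl) e f he hef
  obtain ⟨r, hr0, hrs⟩ := exists_sum_lie_lie_eq_smul ψ hψ e f he hf hef hr α y hyα
  obtain ⟨r', hr0', hrs'⟩ := exists_sum_lie_lie_eq_smul (-ψ)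
    (fun γ hγ ↦ by simpa using hψ γ hγ) e f he hf hef hr β x hx
  have h0 : ∀ χ : Weight ℂ H L, ψ χ.toLinear ≠ 0 → χ.IsNonZero := fun χ h h' ↦ by
    rw [Weight.coe_toLinear_eq_zero_iff.2 h', map_zero] at h; exact h rfl
  have hsum : ∑ χ : Weight ℂ H L with χ.IsNonZero, killingForm ℂ L (B (e χ)) (f χ) =
      (r + r') * killingForm ℂ L y w := by
    have hsplit : (Finset.univ.filter fun χ : Weight ℂ H L ↦ χ.IsNonZero) =
        (Finset.univ.filter fun χ : Weight ℂ H L ↦ 0 < ψ χ.toLinear) ∪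
        (Finset.univ.filter fun χ : Weight ℂ H L ↦ 0 < (-ψ) χ.toLinear) := by
      ext χ
      simp only [Finset.mem_filter, Finset.mem_univ, true_and, Finset.mem_union,
        LinearMap.neg_apply, neg_pos]
      refine ⟨fun h ↦ (lt_or_gt_of_ne (hψ χ h)).symm, ?_⟩
      rintro (h | h)
      · exact h0 χ h.ne'
      · exact h0 χ h.ne
    have hdisj : Disjoint (Finset.univ.filter fun χ : Weight ℂ H L ↦ 0 < ψ χ.toLinear)
        (Finset.univ.filter fun χ : Weight ℂ H L ↦ 0 < (-ψ) χ.toLinear) := by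
      rw [Finset.disjoint_filter]
      intro χ _ h h'
      rw [LinearMap.neg_apply, neg_pos] at h'
      exact lt_asymm h h'
    rw [hsplit, Finset.sum_union hdisj, add_mul]
    congr 1
    -- For positive χ, `e χ` moves through `A` onto `y`; for negative χ, below, the positive root
    -- vector `f χ` moves inside `A` onto `x`.
    · rw [← smul_eq_mul, ← LinearMap.smul_apply, ← map_smul, ← hrs, map_sum, LinearMap.sum_apply]
      refine Finset.sum_congr rfl fun χ hχ ↦ ?_
      have hχ' : 0 < ψ χ.toLinear := by simpa using hχ
      have hm := he χ (h0 χ hχ'.ne')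
      rw [hBapp, ← lie_skew x (e χ), map_neg, ← hpos χ hχ' _ hm, ← hy, lie_neg, map_neg,
        LinearMap.neg_apply]
      change -(traceForm ℂ L L ⁅w, _⁆ _) = traceForm ℂ L L ⁅_, _⁆ w
      rw [traceForm_apply_lie_apply, traceForm_comm ℂ L L w, ← lie_skew (f χ), map_neg,
        LinearMap.neg_apply]
    · rw [← smul_eq_mul, ← LinearMap.smul_apply, ← map_smul, hy, ← map_smul, ← hrs', map_sum,
        map_sum, LinearMap.sum_apply]
      refine Finset.sum_congr rfl fun χ hχ ↦ ?_
      have hχ' : ψ χ.toLinear < 0 := by simpa using hχ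
      have hm := hf χ (h0 χ hχ'.ne)
      rw [hBapp, ← lie_skew x (e χ), map_neg, lie_neg, map_neg, LinearMap.neg_apply,
        ← hpos (-χ) (by simpa using hχ') _ hm]
      change -(traceForm ℂ L L ⁅w, _⁆ _) = traceForm ℂ L L ⁅_, _⁆ w
      rw [traceForm_apply_lie_apply, traceForm_comm ℂ L L w, ← lie_skew (f χ), map_neg,
        LinearMap.neg_apply]
  have h1 := hμ x w
  rw [← hBdef, htr, hsum, ← hy] at h1
  have h2 : μ = -killingForm ℂ L ((cartanEquivDual H).symm β.toLinear : H)
      ((cartanEquivDual H).symm α.toLinear : H) - r - r' := by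
    apply mul_right_cancel₀ hyw
    rw [← h1]; ring
  have h3 := neg_re_killingForm_le hc hroot β α
  rw [h2]
  simp only [Complex.sub_re, Complex.neg_re, Complex.ofReal_re]
  linarith

end Trace

/-! ### Reduction of the eigenvalue bound to highest weight vectors -/

section Eigenvalue

variable {L : Type*} [LieRing L] [LieAlgebra ℂ L] [FiniteDimensional ℂ L]

/-- The eigenspace of `A ↦ -∑ᵢ ad xᵢ ∘ A ∘ ad xⁱ`, for dual bases with respect to the Killing
form, in the endomorphisms of a Lie algebra. -/
def adEigenspace (L : Type*) [LieRing L] [LieAlgebra ℂ L] [FiniteDimensional ℂ L] (μ : ℂ) :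
    LieSubmodule ℂ L (L →ₗ[ℂ] L) where
  carrier := {A | ∀ z w : L, -LinearMap.trace ℂ L (ad ℂ L w ∘ₗ A ∘ₗ ad ℂ L z) =
      μ * killingForm ℂ L (A z) w}
  add_mem' {A A'} hA hA' z w := by
    rw [LinearMap.add_comp, LinearMap.comp_add, map_add, neg_add, hA, hA', LinearMap.add_apply,
      map_add, LinearMap.add_apply, mul_add]
  zero_mem' z w := by simp
  smul_mem' c A hA z w := by
    rw [LinearMap.smul_comp, LinearMap.comp_smul, map_smul, ← smul_neg, hA, LinearMap.smul_apply,
      map_smul, LinearMap.smul_apply, smul_eq_mul, smul_eq_mul]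
    ring
  -- Stability under the Lie action follows from the invariance of the Killing form and the
  -- cyclicity of the trace.
  lie_mem {x A} hA z w := by
    have h1 := hA z ⁅w, x⁆
    have h2 := hA ⁅x, z⁆ w
    have hlie : ⁅x, A⁆ = ad ℂ L x * A - A * ad ℂ L x := by ext u; simp
    have h3 : killingForm ℂ L ⁅x, A z⁆ w = killingForm ℂ L (A z) ⁅w, x⁆ := by
      change traceForm ℂ L L _ _ = traceForm ℂ L L _ _
      rw [traceForm_apply_lie_apply', ← lie_skew x w, map_neg, neg_neg]
    have h4 : LinearMap.trace ℂ L (ad ℂ L w * (⁅x, A⁆ : End ℂ L) * ad ℂ L z) =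
        LinearMap.trace ℂ L (ad ℂ L ⁅w, x⁆ * A * ad ℂ L z) -
          LinearMap.trace ℂ L (ad ℂ L w * A * ad ℂ L ⁅x, z⁆) := by
      have had : ∀ u v : L, ad ℂ L ⁅u, v⁆ = ad ℂ L u * ad ℂ L v - ad ℂ L v * ad ℂ L u := by
        intro u v; ext t; simp
      rw [hlie, had, had]
      have h5 := LinearMap.trace_mul_comm ℂ (ad ℂ L x) (ad ℂ L w * A * ad ℂ L z)
      simp only [mul_sub, sub_mul, map_sub, mul_assoc] at h5 ⊢
      rw [h5]; ring
    change -LinearMap.trace ℂ L (ad ℂ L w * ((⁅x, A⁆ : End ℂ L) * ad ℂ L z)) = _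
    change -LinearMap.trace ℂ L (ad ℂ L ⁅w, x⁆ * (A * ad ℂ L z)) = _ at h1
    change -LinearMap.trace ℂ L (ad ℂ L w * (A * ad ℂ L ⁅x, z⁆)) = _ at h2
    rw [← mul_assoc] at h1 h2 ⊢
    rw [h4, neg_sub, ← neg_sub_neg, h1, h2, LieHom.lie_apply, map_sub, LinearMap.sub_apply, h3]
    ring

theorem re_le_of_mem_adEigenspace [IsKilling ℂ L] {H : LieSubalgebra ℂ L} [H.IsCartanSubalgebra]
    {c : ℝ} (hc : 0 < c) (hroot : ∀ α : Weight ℂ H L, α.IsNonZero →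
      c ≤ (killingForm ℂ L (coroot α : H) (coroot α : H)).re)
    {μ : ℂ} {A : L →ₗ[ℂ] L} (hA : A ∈ adEigenspace L μ) (hA0 : A ≠ 0) : μ.re ≤ 4 / c := by
  obtain ⟨ψ, hψ⟩ := exists_real_dual_forall_root_ne_zero (H := H)
  have : Nontrivial (adEigenspace L μ) :=
    ⟨⟨A, hA⟩, 0, fun h ↦ hA0 (congr_arg Subtype.val h)⟩
  obtain ⟨l, ⟨A', hA'⟩, hne, hl, hpos⟩ := exists_highest_weight_vector (adEigenspace L μ) ψ
  refine re_le_of_highest_weight hc hroot ψ hψ (A := A')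
    (fun h ↦ hne (Subtype.ext h)) hA' (l := l) (fun h u ↦ ?_) fun γ hγ e he u ↦ ?_
  · have h1 : ⁅(h : L), A'⁆ = l h • A' := congr_arg Subtype.val (hl h)
    have h2 := congr($h1 u)
    rw [LieHom.lie_apply, sub_eq_iff_eq_add] at h2
    exact h2
  · have h1 : ⁅e, A'⁆ = 0 := congr_arg Subtype.val (hpos γ hγ e he)
    have h2 := congr($h1 u)
    rw [LieHom.lie_apply, LinearMap.zero_apply, sub_eq_zero] at h2
    exact h2

end Eigenvalue

/-! ### Complexification and the dual Coxeter number -/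

section Compact

theorem exists_eq_one_tmul_add_I_tmul {E : Type*} [AddCommGroup E] [Module ℝ E] (u : ℂ ⊗[ℝ] E) :
    ∃ x y : E, u = 1 ⊗ₜ x + Complex.I ⊗ₜ y := by
  induction u with
  | zero => exact ⟨0, 0, by simp⟩
  | tmul a x =>
    refine ⟨a.re • x, a.im • x, ?_⟩
    rw [← TensorProduct.smul_tmul, ← TensorProduct.smul_tmul, ← TensorProduct.add_tmul]
    congr 1
    apply Complex.ext <;> simp
  | add u v hu hv =>
    obtain ⟨x, y, rfl⟩ := hu
    obtain ⟨x', y', rfl⟩ := hv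
    exact ⟨x + x', y + y', by rw [TensorProduct.tmul_add, TensorProduct.tmul_add]; abel⟩

variable {𝔤 : Type*} [LieRing 𝔤] [LieAlgebra ℝ 𝔤] [FiniteDimensional ℝ 𝔤]

theorem killingForm_tmul_tmul (a b : ℂ) (x y : 𝔤) :
    killingForm ℂ (ℂ ⊗[ℝ] 𝔤) (a ⊗ₜ x) (b ⊗ₜ y) = b * a * killingForm ℝ 𝔤 x y := by
  have h : killingForm ℂ (ℂ ⊗[ℝ] 𝔤) = (killingForm ℝ 𝔤).baseChange ℂ :=
    traceForm_baseChange ℝ 𝔤 𝔤 ℂ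
  rw [h, LinearMap.BilinForm.baseChange_tmul, Complex.real_smul]
  ring

theorem HasNegDefKillingForm.isKilling_complexification (h : HasNegDefKillingForm 𝔤) :
    IsKilling ℂ (ℂ ⊗[ℝ] 𝔤) := by
  constructor
  rw [LieSubmodule.eq_bot_iff]
  intro u hu
  obtain ⟨x, y, rfl⟩ := exists_eq_one_tmul_add_I_tmul u
  rw [LieIdeal.mem_killingCompl] at hu
  have key : ∀ z : 𝔤, killingForm ℝ 𝔤 z x = 0 ∧ killingForm ℝ 𝔤 z y = 0 := by
    intro z
    have h1 : killingForm ℂ (ℂ ⊗[ℝ] 𝔤) (1 ⊗ₜ z) (1 ⊗ₜ x + Complex.I ⊗ₜ y) = 0 :=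
      hu (1 ⊗ₜ z) (LieSubmodule.mem_top _)
    rw [map_add, killingForm_tmul_tmul, killingForm_tmul_tmul] at h1
    have hre := congr_arg Complex.re h1
    have him := congr_arg Complex.im h1
    simp at hre him
    exact ⟨hre, him⟩
  have hx : x = 0 := by
    by_contra h0
    exact (h x h0).ne (key x).1
  have hy : y = 0 := by
    by_contra h0
    exact (h y h0).ne (key y).2
  simp [hx, hy]

/-- This makes the set defining `dualCoxeterNumber` nonempty, so that its infimum is not the default
value 0. -/
theorem exists_coroot_of_nontrivial [Nontrivial 𝔤] (h : HasNegDefKillingForm 𝔤) :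
    ∃ (_ : IsKilling ℂ (ℂ ⊗[ℝ] 𝔤)) (H : LieSubalgebra ℂ (ℂ ⊗[ℝ] 𝔤)) (_ : H.IsCartanSubalgebra)
      (α : Weight ℂ H (ℂ ⊗[ℝ] 𝔤)), α.IsNonZero := by
  have hK := h.isKilling_complexification
  have : Nontrivial (ℂ ⊗[ℝ] 𝔤) := by
    obtain ⟨x, hx⟩ := exists_ne (0 : 𝔤)
    refine ⟨1 ⊗ₜ x, 0, fun h0 ↦ (h x hx).ne ?_⟩
    have h1 := killingForm_tmul_tmul (1 : ℂ) 1 x x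
    rw [h0] at h1
    simpa using h1.symm
  obtain ⟨x, hH⟩ := exists_isCartanSubalgebra_engel ℂ (ℂ ⊗[ℝ] 𝔤)
  refine ⟨hK, _, hH, ?_⟩
  by_contra! hcon
  have h1 := span_weight_isNonZero_eq_top ℂ (ℂ ⊗[ℝ] 𝔤) (LieSubalgebra.engel ℂ x)
  have h2 : {α : Weight ℂ (LieSubalgebra.engel ℂ x) (ℂ ⊗[ℝ] 𝔤) | α.IsNonZero} = ∅ := by
    ext α; simpa using hcon α
  rw [h2, Set.image_empty, Submodule.span_empty] at h1
  exact bot_ne_top h1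

theorem HasNegDefKillingForm.two_le_dualCoxeterNumber [Nontrivial 𝔤]
    (h : HasNegDefKillingForm 𝔤) : 2 ≤ dualCoxeterNumber 𝔤 := by
  obtain ⟨hK, H, hH, α, hα⟩ := exists_coroot_of_nontrivial h
  refine le_csInf ⟨_, hK, H, hH, α, hα, rfl⟩ ?_
  rintro r ⟨hK, H, hH, α, hα, rfl⟩
  obtain ⟨q, hq, hq'⟩ := exists_real_killingForm_coroot α hα
  rw [hq', Complex.ofReal_re]
  linarith

theorem four_mul_dualCoxeterNumber_le [hK : IsKilling ℂ (ℂ ⊗[ℝ] 𝔤)]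
    {H : LieSubalgebra ℂ (ℂ ⊗[ℝ] 𝔤)} [hH : H.IsCartanSubalgebra]
    (α : Weight ℂ H (ℂ ⊗[ℝ] 𝔤)) (hα : α.IsNonZero) :
    4 * dualCoxeterNumber 𝔤 ≤ (killingForm ℂ (ℂ ⊗[ℝ] 𝔤) (coroot α : H) (coroot α : H)).re := by
  have : dualCoxeterNumber 𝔤 ≤
      (killingForm ℂ (ℂ ⊗[ℝ] 𝔤) (coroot α : H) (coroot α : H)).re / 4 := by
    refine csInf_le ⟨0, ?_⟩ ⟨hK, H, hH, α, hα, rfl⟩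
    rintro r ⟨hK, H, hH, α, hα, rfl⟩
    obtain ⟨q, hq, hq'⟩ := exists_real_killingForm_coroot α hα
    rw [hq', Complex.ofReal_re]
    linarith
  linarith

theorem baseChange_mem_adEigenspace {A : End ℝ 𝔤} {μ : ℝ}
    (hA : ∀ z w : 𝔤, -LinearMap.trace ℝ 𝔤 (ad ℝ 𝔤 w ∘ₗ A ∘ₗ ad ℝ 𝔤 z) =
      μ * killingForm ℝ 𝔤 (A z) w) :
    A.baseChange ℂ ∈ adEigenspace (ℂ ⊗[ℝ] 𝔤) μ := by
  have had : ∀ (a : ℂ) (z : 𝔤),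
      ad ℂ (ℂ ⊗[ℝ] 𝔤) (a ⊗ₜ z) = a • (ad ℝ 𝔤 z).baseChange ℂ := by
    intro a z; ext u; simp [TensorProduct.smul_tmul']
  intro z w
  induction z with
  | zero => simp
  | add z z' hz hz' =>
    rw [map_add, LinearMap.comp_add, LinearMap.comp_add, map_add, neg_add, hz, hz', map_add,
      map_add, LinearMap.add_apply, mul_add]
  | tmul a z =>
    induction w with
    | zero => simp
    | add w w' hw hw' =>
      rw [map_add, LinearMap.add_comp, map_add, neg_add, hw, hw', map_add, mul_add]
    | tmul b w =>
      rw [had, had, LinearMap.comp_smul, LinearMap.comp_smul, LinearMap.smul_comp,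
        ← LinearMap.baseChange_comp, ← LinearMap.baseChange_comp, map_smul, map_smul,
        LinearMap.trace_baseChange, LinearMap.baseChange_tmul, killingForm_tmul_tmul]
      have h1 : ((-LinearMap.trace ℝ 𝔤 (ad ℝ 𝔤 w ∘ₗ A ∘ₗ ad ℝ 𝔤 z) : ℝ) : ℂ) =
        ((μ * killingForm ℝ 𝔤 (A z) w : ℝ) : ℂ) := by rw [hA]
      push_cast at h1
      simp only [smul_eq_mul, Complex.coe_algebraMap]
      linear_combination a * b * h1

/-- The largest eigenvalue of `A ↦ -∑ᵢ ad xᵢ ∘ A ∘ ad xⁱ`, for dual bases with respect to the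
Killing form, is at most the inverse of the dual Coxeter number. -/
theorem HasNegDefKillingForm.mul_dualCoxeterNumber_le_one [Nontrivial 𝔤]
    (h : HasNegDefKillingForm 𝔤) {A : End ℝ 𝔤} (hA0 : A ≠ 0) {μ : ℝ}
    (hA : ∀ z w : 𝔤, -LinearMap.trace ℝ 𝔤 (ad ℝ 𝔤 w ∘ₗ A ∘ₗ ad ℝ 𝔤 z) =
      μ * killingForm ℝ 𝔤 (A z) w) : μ * dualCoxeterNumber 𝔤 ≤ 1 := by
  obtain ⟨hK, H, hH, -, -⟩ := exists_coroot_of_nontrivial h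
  have hv : 0 < dualCoxeterNumber 𝔤 := by linarith [h.two_le_dualCoxeterNumber]
  have hne : A.baseChange ℂ ≠ 0 := by
    intro h0
    apply hA0
    ext z
    by_contra hz
    have h1 := killingForm_tmul_tmul (1 : ℂ) 1 (A z) (A z)
    rw [← LinearMap.baseChange_tmul, h0] at h1
    refine (h (A z) hz).ne ?_
    simpa using h1.symm
  have h1 := re_le_of_mem_adEigenspace (H := H) (c := 4 * dualCoxeterNumber 𝔤) (by linarith)
    (fun α hα ↦ four_mul_dualCoxeterNumber_le α hα) (baseChange_mem_adEigenspace hA) hne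
  rw [Complex.ofReal_re, le_div_iff₀ (by linarith)] at h1
  linarith

end Compact

/-! ### The normalised invariant form -/

section NormalizedForm

variable {𝔤 : Type*} [LieRing 𝔤] [LieAlgebra ℝ 𝔤] [FiniteDimensional ℝ 𝔤]

theorem normalizedForm_apply (x y : 𝔤) :
    normalizedForm 𝔤 x y = -(2 * dualCoxeterNumber 𝔤)⁻¹ * killingForm ℝ 𝔤 x y := rfl

theorem normalizedForm_comm (x y : 𝔤) : normalizedForm 𝔤 x y = normalizedForm 𝔤 y x := by
  rw [normalizedForm_apply, normalizedForm_apply]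
  congr 1
  exact traceForm_comm ℝ 𝔤 𝔤 x y

theorem normalizedForm_lie_left (x y z : 𝔤) :
    normalizedForm 𝔤 ⁅x, y⁆ z = normalizedForm 𝔤 x ⁅y, z⁆ := by
  rw [normalizedForm_apply, normalizedForm_apply]
  congr 1
  exact traceForm_apply_lie_apply ℝ 𝔤 𝔤 x y z

theorem HasNegDefKillingForm.normalizedForm_nondegenerate [Nontrivial 𝔤]
    (h : HasNegDefKillingForm 𝔤) : (normalizedForm 𝔤).Nondegenerate := by
  have hv : 0 < dualCoxeterNumber 𝔤 := by linarith [h.two_le_dualCoxeterNumber]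
  have key : ∀ x : 𝔤, normalizedForm 𝔤 x x = 0 → x = 0 := by
    intro x hx
    by_contra h0
    rw [normalizedForm_apply] at hx
    have : -(2 * dualCoxeterNumber 𝔤)⁻¹ ≠ 0 := by simp [hv.ne']
    exact mul_ne_zero this (h x h0).ne hx
  exact ⟨fun x hx ↦ key x (hx x), fun x hx ↦ key x (hx x)⟩

end NormalizedForm

/-! ### Vectors of energy two and their scalar products -/

namespace CurrentAlgebra

variable {𝔤 : Type*} [LieRing 𝔤] [LieAlgebra ℝ 𝔤] [FiniteDimensional ℝ 𝔤] {k : ℕ}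
  {V : Type*} [NormedAddCommGroup V] [InnerProductSpace ℂ V] (J : CurrentAlgebra 𝔤 k V)

theorem mode_mode (m n : ℤ) (X Y : 𝔤) (v : V) :
    J.mode m X (J.mode n Y v) = J.mode n Y (J.mode m X v) + (Complex.I • J.mode (m + n) ⁅X, Y⁆ v +
      (if m + n = 0 then (k : ℂ) * (m : ℂ) * (normalizedForm 𝔤 X Y : ℂ) else 0) • v) := by
  have h := congr($(J.comm m n X Y) v)
  rw [← sub_eq_iff_eq_add']
  exact h

/-- Every summand except m = −1 has a mode of nonnegative index acting on the vacuum. -/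
theorem normalOrderedMode_neg_two_vacuum (X Y : 𝔤) :
    J.normalOrderedMode X Y (-2) J.vacuum = J.mode (-1) X (J.mode (-1) Y J.vacuum) := by
  unfold normalOrderedMode
  rw [finsum_eq_single _ (-1)]
  · simp [normalOrderedTerm]
  · intro m hm
    unfold normalOrderedTerm
    split_ifs with h
    · simp [J.mode_vacuum (-2 - m) (by omega)]
    · simp [J.mode_vacuum m (by omega)]

theorem mode_one_mode_neg_one_vacuum (Z Y : 𝔤) :
    J.mode 1 Z (J.mode (-1) Y J.vacuum) = ((k * normalizedForm 𝔤 Z Y : ℝ) : ℂ) • J.vacuum := by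
  rw [mode_mode, J.mode_vacuum 1 (by norm_num), J.mode_vacuum (1 + -1) (by norm_num)]
  simp

theorem mode_zero_mode_neg_one_vacuum (U Y : 𝔤) :
    J.mode 0 U (J.mode (-1) Y J.vacuum) = Complex.I • J.mode (-1) ⁅U, Y⁆ J.vacuum := by
  rw [mode_mode, J.mode_vacuum 0 le_rfl]
  simp

theorem inner_mode_mode_vacuum (Z W X Y : 𝔤) :
    inner ℂ (J.mode (-1) Z (J.mode (-1) W J.vacuum)) (J.mode (-1) X (J.mode (-1) Y J.vacuum)) =
      ((k ^ 2 * (normalizedForm 𝔤 Z X * normalizedForm 𝔤 W Y +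
        normalizedForm 𝔤 Z Y * normalizedForm 𝔤 W X) +
        k * normalizedForm 𝔤 ⁅Z, X⁆ ⁅W, Y⁆ : ℝ) : ℂ) := by
  have h1 : J.mode 1 Z (J.mode (-1) X (J.mode (-1) Y J.vacuum)) =
      ((k * normalizedForm 𝔤 Z Y : ℝ) : ℂ) • J.mode (-1) X J.vacuum -
        J.mode (-1) ⁅⁅Z, X⁆, Y⁆ J.vacuum +
          ((k * normalizedForm 𝔤 Z X : ℝ) : ℂ) • J.mode (-1) Y J.vacuum := by
    rw [mode_mode, mode_one_mode_neg_one_vacuum, map_smul,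
      show (1 : ℤ) + -1 = 0 by norm_num, mode_zero_mode_neg_one_vacuum, smul_smul, Complex.I_mul_I]
    simp only [if_true]
    push_cast
    module
  have h2 : normalizedForm 𝔤 W ⁅⁅Z, X⁆, Y⁆ = -normalizedForm 𝔤 ⁅Z, X⁆ ⁅W, Y⁆ := by
    rw [← normalizedForm_lie_left, ← lie_skew, map_neg, LinearMap.neg_apply,
      normalizedForm_lie_left]
  rw [J.symm, J.symm, neg_neg, h1, map_add, map_sub, map_smul, map_smul,
    mode_one_mode_neg_one_vacuum, mode_one_mode_neg_one_vacuum, mode_one_mode_neg_one_vacuum,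
    h2, smul_smul, smul_smul, ← sub_smul, ← add_smul, inner_smul_right,
    inner_self_eq_norm_sq_to_K, J.norm_vacuum]
  push_cast
  ring

/-- The pairs of an operator on `𝔤`, seen as a tensor in `𝔤 ⊗ 𝔤` by means of the invariant form,
and a vector, such that the vector has the same scalar products as the image of the tensor under
`X ⊗ Y ↦ j₋₁(X) j₋₁(Y) Ω` with all vectors of this kind. -/
def gramGraph : Submodule ℝ (End ℝ 𝔤 × V) where
  carrier := {p | ∀ Z W : 𝔤, inner ℂ (J.mode (-1) Z (J.mode (-1) W J.vacuum)) p.2 =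
    ((k ^ 2 * (normalizedForm 𝔤 (p.1 Z) W + normalizedForm 𝔤 (p.1 W) Z) -
      k * LinearMap.trace ℝ 𝔤 (ad ℝ 𝔤 W ∘ₗ p.1 ∘ₗ ad ℝ 𝔤 Z) : ℝ) : ℂ)}
  add_mem' {p q} hp hq Z W := by
    rw [Prod.snd_add, inner_add_right, hp, hq, ← Complex.ofReal_add]
    simp only [Prod.fst_add, LinearMap.add_apply, map_add, LinearMap.add_comp, LinearMap.comp_add]
    congr 1; ring
  zero_mem' Z W := by simp
  smul_mem' c p hp Z W := by
    rw [Prod.smul_snd, ← Complex.coe_smul, inner_smul_right, hp, ← Complex.ofReal_mul]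
    simp only [Prod.smul_fst, LinearMap.smul_apply, map_smul, LinearMap.smul_comp,
      LinearMap.comp_smul, smul_eq_mul]
    congr 1; ring

/-- The tensor X ⊗ Y becomes the rank one operator ⟨X, ·⟩Y. The term k⟨[Z, X], [W, Y]⟩ of the Gram
form is then −k times a trace of a rank one operator. -/
theorem smulRight_mem_gramGraph (X Y : 𝔤) :
    ((normalizedForm 𝔤 X).smulRight Y, J.mode (-1) X (J.mode (-1) Y J.vacuum)) ∈ J.gramGraph := by
  intro Z W
  have h1 : ad ℝ 𝔤 W ∘ₗ (normalizedForm 𝔤 X).smulRight Y ∘ₗ ad ℝ 𝔤 Z =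
      ((normalizedForm 𝔤 X).comp (ad ℝ 𝔤 Z)).smulRight ⁅W, Y⁆ := by
    ext u; simp
  have h2 : normalizedForm 𝔤 X ⁅Z, ⁅W, Y⁆⁆ = -normalizedForm 𝔤 ⁅Z, X⁆ ⁅W, Y⁆ := by
    rw [← normalizedForm_lie_left, ← lie_skew, map_neg, LinearMap.neg_apply]
  rw [inner_mode_mode_vacuum]
  simp only
  rw [h1, LinearMap.trace_smulRight, LinearMap.comp_apply, ad_apply, h2]
  simp only [LinearMap.smulRight_apply, map_smul, LinearMap.smul_apply, smul_eq_mul]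
  rw [normalizedForm_comm X Z, normalizedForm_comm X W, normalizedForm_comm Y W,
    normalizedForm_comm Y Z]
  congr 1; ring

/-! ### Sugawara tensors as operators -/

section Sugawara

variable {S : Type*} [AddCommGroup S] [Module ℝ S] [FiniteDimensional ℝ S]

/-- The inverse Gram matrix of `g` with respect to a basis of `S`. -/
noncomputable def inverseGram (g : LinearMap.BilinForm ℝ S) :
    Matrix (Fin (finrank ℝ S)) (Fin (finrank ℝ S)) ℝ :=
  (Matrix.of fun a b => g (finBasis ℝ S a) (finBasis ℝ S b))⁻¹

/-- The operator on `𝔤` corresponding to the tensor which defines the Sugawara modes. -/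
noncomputable def sugawaraOperator (φ : S →ₗ[ℝ] 𝔤) (g : LinearMap.BilinForm ℝ S) (c : ℝ) : End ℝ 𝔤 :=
  (1 / (2 * c)) • ∑ a, ∑ b, inverseGram g a b •
    (normalizedForm 𝔤 (φ (finBasis ℝ S a))).smulRight (φ (finBasis ℝ S b))

theorem sugawaraOperator_mem_gramGraph (φ : S →ₗ[ℝ] 𝔤) (g : LinearMap.BilinForm ℝ S) (c : ℝ) :
    (sugawaraOperator φ g c, J.sugawaraMode φ g c (-2) J.vacuum) ∈ J.gramGraph := by
  have h : (sugawaraOperator φ g c, J.sugawaraMode φ g c (-2) J.vacuum) =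
      (1 / (2 * c)) • ∑ a, ∑ b, inverseGram g a b •
        (((normalizedForm 𝔤 (φ (finBasis ℝ S a))).smulRight (φ (finBasis ℝ S b)) : End ℝ 𝔤),
          J.mode (-1) (φ (finBasis ℝ S a)) (J.mode (-1) (φ (finBasis ℝ S b)) J.vacuum)) := by
    refine Prod.ext ?_ ?_
    · simp only [Prod.smul_fst, Prod.fst_sum, sugawaraOperator]
    · simp only [Prod.smul_snd, Prod.snd_sum, sugawaraMode, inverseGram,
        normalOrderedMode_neg_two_vacuum, Complex.coe_smul]
  rw [h]
  exact Submodule.smul_mem _ _ <| Submodule.sum_mem _ fun a _ ↦ Submodule.sum_mem _ fun b _ ↦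
    Submodule.smul_mem _ _ <| J.smulRight_mem_gramGraph _ _

theorem range_sugawaraOperator_le (φ : S →ₗ[ℝ] 𝔤) (g : LinearMap.BilinForm ℝ S) (c : ℝ) :
    LinearMap.range (sugawaraOperator φ g c) ≤ LinearMap.range φ := by
  rintro _ ⟨x, rfl⟩
  simp only [sugawaraOperator, LinearMap.smul_apply, LinearMap.coe_sum, Finset.sum_apply,
    LinearMap.smulRight_apply]
  exact Submodule.smul_mem _ _ <| Submodule.sum_mem _ fun a _ ↦ Submodule.sum_mem _ fun b _ ↦
    Submodule.smul_mem _ _ <| Submodule.smul_mem _ _ <| LinearMap.mem_range_self _ _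

theorem normalizedForm_sugawaraOperator (φ : S →ₗ[ℝ] 𝔤) {g : LinearMap.BilinForm ℝ S}
    (hg : ∀ x y, g x y = g y x) (c : ℝ) (x y : 𝔤) :
    normalizedForm 𝔤 (sugawaraOperator φ g c x) y =
      normalizedForm 𝔤 x (sugawaraOperator φ g c y) := by
  have hG : ∀ a b, inverseGram g a b = inverseGram g b a := by
    intro a b
    have h1 : (inverseGram g).transpose = inverseGram g := by
      rw [inverseGram, Matrix.transpose_nonsing_inv]
      congr 1; ext i j; exact hg _ _
    exact congr($h1 b a)
  simp only [sugawaraOperator, LinearMap.smul_apply, LinearMap.coe_sum, Finset.sum_apply,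
    LinearMap.smulRight_apply, map_smul, map_sum, smul_eq_mul]
  congr 1
  rw [Finset.sum_comm]
  refine Finset.sum_congr rfl fun a _ ↦ Finset.sum_congr rfl fun b _ ↦ ?_
  rw [hG, normalizedForm_comm _ y, normalizedForm_comm x, normalizedForm_comm y]
  ring

theorem sugawaraOperator_id (h : (normalizedForm 𝔤).Nondegenerate) (c : ℝ) :
    sugawaraOperator LinearMap.id (normalizedForm 𝔤) c = (1 / (2 * c)) • (1 : End ℝ 𝔤) := by
  unfold sugawaraOperator
  congr 1
  refine (finBasis ℝ 𝔤).ext fun d ↦ ?_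
  set G : Matrix (Fin (finrank ℝ 𝔤)) (Fin (finrank ℝ 𝔤)) ℝ :=
    Matrix.of fun a b => normalizedForm 𝔤 (finBasis ℝ 𝔤 a) (finBasis ℝ 𝔤 b) with hG
  have hdet : G.det ≠ 0 := by
    have := (LinearMap.BilinForm.nondegenerate_iff_det_ne_zero (finBasis ℝ 𝔤)).1 h
    convert this using 2
    ext a b; simp [hG, LinearMap.BilinForm.toMatrix_apply]
  have hinv : G * inverseGram (normalizedForm 𝔤) = 1 :=
    Matrix.mul_nonsing_inv G (isUnit_iff_ne_zero.2 hdet)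
  simp only [LinearMap.coe_sum, Finset.sum_apply, LinearMap.smul_apply, LinearMap.smulRight_apply,
    LinearMap.id_apply, smul_smul, Module.End.one_apply]
  rw [Finset.sum_comm]
  have h1 : ∀ b, ∑ a, (inverseGram (normalizedForm 𝔤) a b *
      normalizedForm 𝔤 (finBasis ℝ 𝔤 a) (finBasis ℝ 𝔤 d)) • finBasis ℝ 𝔤 b =
        (1 : Matrix (Fin (finrank ℝ 𝔤)) (Fin (finrank ℝ 𝔤)) ℝ) d b • finBasis ℝ 𝔤 b := by
    intro b
    rw [← Finset.sum_smul, ← hinv, Matrix.mul_apply]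
    congr 1
    refine Finset.sum_congr rfl fun a _ ↦ ?_
    rw [hG, Matrix.of_apply, normalizedForm_comm, mul_comm]
  simp [h1, Matrix.one_apply]

end Sugawara

variable {𝔥 : Type*} [LieRing 𝔥] [LieAlgebra ℝ 𝔥] [FiniteDimensional ℝ 𝔥]

/-- Symmetry and the range survive sums, so the coefficients of the individual ideals play no role.
-/
theorem exists_operator_subStressEnergy (ι : 𝔥 →ₗ⁅ℝ⁆ 𝔤) :
    ∃ A : End ℝ 𝔤, (A, J.subStressEnergy ι (-2) J.vacuum) ∈ J.gramGraph ∧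
      (∀ x y, normalizedForm 𝔤 (A x) y = normalizedForm 𝔤 x (A y)) ∧
      LinearMap.range A ≤ LinearMap.range (ι : 𝔥 →ₗ[ℝ] 𝔤) := by
  let P : V → Prop := fun v ↦ ∃ A : End ℝ 𝔤, (A, v) ∈ J.gramGraph ∧
      (∀ x y, normalizedForm 𝔤 (A x) y = normalizedForm 𝔤 x (A y)) ∧
      LinearMap.range A ≤ LinearMap.range (ι : 𝔥 →ₗ[ℝ] 𝔤)
  have hadd : ∀ v w, P v → P w → P (v + w) := by
    rintro v w ⟨A, hA, hA', hA''⟩ ⟨B, hB, hB', hB''⟩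
    refine ⟨A + B, J.gramGraph.add_mem hA hB, fun x y ↦ ?_, ?_⟩
    · simp only [LinearMap.add_apply, map_add, hA', hB']
    · rintro _ ⟨x, rfl⟩
      exact Submodule.add_mem _ (hA'' ⟨x, rfl⟩) (hB'' ⟨x, rfl⟩)
  have hsug : ∀ (I : LieIdeal ℝ 𝔥) (g : LinearMap.BilinForm ℝ I), (∀ x y, g x y = g y x) →
      ∀ c : ℝ, P (J.sugawaraMode (ι.comp (LieIdeal.incl I) : I →ₗ[ℝ] 𝔤) g c (-2) J.vacuum) := by
    intro I g hg c
    refine ⟨_, J.sugawaraOperator_mem_gramGraph _ g c, normalizedForm_sugawaraOperator _ hg c,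
      (range_sugawaraOperator_le _ g c).trans ?_⟩
    rintro _ ⟨x, rfl⟩
    exact ⟨x, rfl⟩
  have hzero : P 0 := by
    refine ⟨0, J.gramGraph.zero_mem, by simp, ?_⟩
    rintro _ ⟨x, rfl⟩
    exact Submodule.zero_mem _
  have hsimple : ∀ I : LieIdeal ℝ 𝔥,
      P (J.simpleStressEnergy (ι.comp (LieIdeal.incl I)) (-2) J.vacuum) := by
    intro I
    unfold simpleStressEnergy
    exact hsug I _ normalizedForm_comm _
  have habelian : P (J.abelianStressEnergy
      (ι.comp (LieIdeal.incl (LieAlgebra.center ℝ 𝔥))) (-2) J.vacuum) := by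
    unfold abelianStressEnergy
    refine hsug _ _ (fun x y ↦ ?_) _
    rw [LinearMap.compl₁₂_apply, LinearMap.compl₁₂_apply, normalizedForm_comm]
  exact hadd _ _ (finsum_induction P hzero hadd fun I ↦ hsimple I.1) habelian

end CurrentAlgebra

end ConformalInclusion

/-! ### The level is one -/

theorem mainTheorem3
    {𝔤 : Type*} [LieRing 𝔤] [LieAlgebra ℝ 𝔤] [FiniteDimensional ℝ 𝔤] [LieAlgebra.IsSimple ℝ 𝔤]
    (h𝔤 : ConformalInclusion.HasNegDefKillingForm 𝔤)
    {𝔥 : Type*} [LieRing 𝔥] [LieAlgebra ℝ 𝔥] [FiniteDimensional ℝ 𝔥]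
    (ι : 𝔥 →ₗ⁅ℝ⁆ 𝔤) (hι : Function.Injective ι) (hproper : ¬ Function.Surjective ι)
    (k : ℕ) (hk : 0 < k)
    {V : Type*} [NormedAddCommGroup V] [InnerProductSpace ℂ V]
    (J : ConformalInclusion.CurrentAlgebra 𝔤 k V)
    (hconf : J.IsConformalInclusion ι) :
    k = 1 := by
  open ConformalInclusion ConformalInclusion.CurrentAlgebra in
  have : Nontrivial 𝔤 := by
    by_contra hn
    rw [not_nontrivial_iff_subsingleton] at hn
    exact hproper fun x ↦ ⟨0, Subsingleton.elim _ _⟩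
  have hv : 0 < dualCoxeterNumber 𝔤 := by linarith [h𝔤.two_le_dualCoxeterNumber]
  have hk' : (0 : ℝ) < k := by exact_mod_cast hk
  obtain ⟨B, hB, hBsymm, hBrange⟩ := J.exists_operator_subStressEnergy ι
  set c : ℝ := 1 / (2 * (k + dualCoxeterNumber 𝔤)) with hc
  have hc0 : c ≠ 0 := by positivity
  have hg : (c • (1 : Module.End ℝ 𝔤), J.stressEnergy (-2) J.vacuum) ∈ J.gramGraph := by
    rw [hc, ← sugawaraOperator_id h𝔤.normalizedForm_nondegenerate]
    exact J.sugawaraOperator_mem_gramGraph _ _ _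
  rw [hconf (-2) J.vacuum] at hB
  -- Conformality makes the vector parts equal, so the difference of the operators is paired with
  -- the zero vector.
  have hsub := J.gramGraph.sub_mem hg hB
  set A : Module.End ℝ 𝔤 := c • (1 : Module.End ℝ 𝔤) - B with hA
  have hAsymm : ∀ x y, normalizedForm 𝔤 (A x) y = normalizedForm 𝔤 x (A y) := by
    intro x y
    simp [hA, hBsymm]
  have hA0 : A ≠ 0 := by
    intro h0
    apply hproper
    intro x
    have h1 : c • x = B x := by
      have := congr($h0 x)
      simpa [hA, sub_eq_zero] using this
    have h2 : x ∈ LinearMap.range (ι : 𝔥 →ₗ[ℝ] 𝔤) := by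
      rw [← Submodule.smul_mem_iff _ hc0, h1]
      exact hBrange ⟨x, rfl⟩
    exact h2
  -- By symmetry of `A` the two k² terms coincide: 2k²⟨Az, w⟩ = k tr(ad w A ad z). Cancel k and
  -- insert ⟨·,·⟩ = −κ/(2v).
  have key : ∀ z w : 𝔤, -LinearMap.trace ℝ 𝔤 (LieAlgebra.ad ℝ 𝔤 w ∘ₗ A ∘ₗ LieAlgebra.ad ℝ 𝔤 z) =
      (k / dualCoxeterNumber 𝔤) * killingForm ℝ 𝔤 (A z) w := by
    intro z w
    have h1 := hsub z w
    simp only [Prod.fst_sub, Prod.snd_sub, sub_self, inner_zero_right] at h1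
    rw [← hA, hAsymm w z, normalizedForm_comm w, eq_comm, Complex.ofReal_eq_zero,
      normalizedForm_apply] at h1
    field_simp at h1 ⊢
    rw [mul_zero, mul_eq_zero] at h1
    linarith [h1.resolve_left hk'.ne']
  have h1 := h𝔤.mul_dualCoxeterNumber_le_one hA0 key
  rw [div_mul_cancel₀ _ hv.ne'] at h1
  have h2 : k ≤ 1 := by exact_mod_cast h1
  omega
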